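/- Let $A\in\mathbb R^{n\times n}$, $B\in\mathbb R^{n\times r}$, $E\in\mathbb R^{n\times p}$, $D\in\mathbb R^{d\times n}$, $H\in\mathbb R^{l\times n}$, $F\in\mathbb R^{l\times p}$. Consider the plant $$\dot x = Ax+Bu+Ew,\qquad z=Dx,\qquad y=Hx+Fw,$$ with a constant unmeasured disturbance $w\in\mathbb R^p$, a constant reference $z_r\in\mathbb R^d$, the PI-regulator $$\dot q = z-z_r,\qquad u=K_1\hat x+K_2q,$$ and the full-order observer of $(x,w)$ $$\frac{d}{dt}\begin{bmatrix}\hat x\\ \hat w\end{bmatrix}=\begin{bmatrix}A&E\\0&0\end{bmatrix}\begin{bmatrix}\hat x\\ \hat w\end{bmatrix}+\begin{bmatrix}B\\0\end{bmatrix}u+L\,(y-H\hat x-F\hat w).$$ A real square matrix is called stable if all its complex eigenvalues have negative real part; $(A,B)$ is stabilizable if $A+BK$ is stable for some real matrix $K$; $(A,H)$ is detectable if $A-LH$ is stable for some real matrix $L$. For a system $\dot x=Ax+Bv$, $y=Cx+Gv$ with $n$ states, $m$ inputs and $k$ outputs, $s\in\mathbb C$ is called a system zero if $$\operatorname{rank}\begin{bmatrix}sI_n-A&-B\\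 C&G\end{bmatrix}<n+\min(m,k).$$ **Theorem.** There exist real gain matrices $K_1,K_2,L$ such that the closed loop is asymptotically stable, i.e. its dynamics matrix in the coordinates $(x,q,\epsilon)$, $\epsilon=(x,w)-(\hat x,\hat w)$, $$\begin{bmatrix}A+BK_1&BK_2&-B[K_1\;\;0]\\ D&0&0\\ 0&0&\begin{bmatrix}A&E\\0&0\end{bmatrix}-L[H\;\;F]\end{bmatrix},$$ is stable, and such that $z(t)\to z_r$ as $t\to\infty$ for all constant disturbances $w$, all constant references $z_r$ and all initial conditions, if and only if (a) $(A,B)$ is stabilizable; (b) $(A,H)$ is detectable; (c) $r\ge d$ and $l\ge p$; (d) $0$ is not a system zero of $\dot x=Ax+Ew,\ y=Hx+Fw$, nor of $\dot x=Ax+Bu,\ z=Dx$. Moreover: (i) the pair $\left(\begin{bmatrix}A&0\\D&0\end{bmatrix},\begin{bmatrix}B\\0\end{bmatrix}\right)$ is stabilizable if and only if $(A,B)$ is stabilizable, $d\le r$, and $0$ is not a system zero of $\dot x=Ax+Bu,\ z=Dx$; (ii) the pair $\left(\begin{bmatrix}A&E\\0&0\end{bmatrix}^{T},\begin{bmatrix}H^T\\F^T\end{bmatrix}\right)$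 is stabilizable if and only if $(A^T,H^T)$ is stabilizable, $l\ge p$, and $0$ is not a system zero of $\dot x=Ax+Ew,\ y=Hx+Fw$. -/

import Mathlib

open Matrix Filter Topology

noncomputable section

/-- All (complex) eigenvalues of the real square matrix `M` have negative real part, i.e. the
linear system `ẋ = M x` is asymptotically stable. -/
def IsHurwitz {ι : Type*} [Fintype ι] [DecidableEq ι] (M : Matrix ι ι ℝ) : Prop :=
  ∀ μ ∈ spectrum ℂ (M.map (algebraMap ℝ ℂ)), μ.re < 0

/-- The pair `(A, B)` is stabilizable: some state feedback `u = K x` makes `A + B K` stable. -/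
def IsStabilizable {ι κ : Type*} [Fintype ι] [DecidableEq ι] [Fintype κ]
    (A : Matrix ι ι ℝ) (B : Matrix ι κ ℝ) : Prop :=
  ∃ K : Matrix κ ι ℝ, IsHurwitz (A + B * K)

/-- The pair `(A, H)` is detectable: some output injection makes `A - L H` stable. -/
def IsDetectable {ι κ : Type*} [Fintype ι] [DecidableEq ι] [Fintype κ]
    (A : Matrix ι ι ℝ) (H : Matrix κ ι ℝ) : Prop :=
  ∃ L : Matrix ι κ ℝ, IsHurwitz (A - L * H)

/-- The system matrix `P(s) = [sI - A, -B; C, G]` of `ẋ = A x + B v, y = C x + G v`. -/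
def systemMatrix {n m k : ℕ} (A : Matrix (Fin n) (Fin n) ℝ) (B : Matrix (Fin n) (Fin m) ℝ)
    (C : Matrix (Fin k) (Fin n) ℝ) (G : Matrix (Fin k) (Fin m) ℝ) (s : ℂ) :
    Matrix (Fin n ⊕ Fin k) (Fin n ⊕ Fin m) ℂ :=
  fromBlocks (s • (1 : Matrix (Fin n) (Fin n) ℂ) - A.map (algebraMap ℝ ℂ))
    (-(B.map (algebraMap ℝ ℂ))) (C.map (algebraMap ℝ ℂ)) (G.map (algebraMap ℝ ℂ))

/-- `s` is a system zero of `ẋ = A x + B v, y = C x + G v` with `m` inputs and `k` outputs: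
the rank of `P(s)` is less than `n + min(m, k)`. -/
def IsSystemZero {n m k : ℕ} (A : Matrix (Fin n) (Fin n) ℝ) (B : Matrix (Fin n) (Fin m) ℝ)
    (C : Matrix (Fin k) (Fin n) ℝ) (G : Matrix (Fin k) (Fin m) ℝ) (s : ℂ) : Prop :=
  (systemMatrix A B C G s).rank < n + min m k

/-- `[A 0; D 0]`: the plant state augmented by the integrator state `q`. -/
def integratorA {n d : ℕ} (A : Matrix (Fin n) (Fin n) ℝ) (D : Matrix (Fin d) (Fin n) ℝ) :
    Matrix (Fin n ⊕ Fin d) (Fin n ⊕ Fin d) ℝ :=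
  fromBlocks A 0 D 0

/-- `[A E; 0 0]`: the plant state augmented by the constant disturbance `w`. -/
def disturbanceA {n p : ℕ} (A : Matrix (Fin n) (Fin n) ℝ) (E : Matrix (Fin n) (Fin p) ℝ) :
    Matrix (Fin n ⊕ Fin p) (Fin n ⊕ Fin p) ℝ :=
  fromBlocks A E 0 0

/-- `[B; 0]`: the input matrix of either augmented system, with `k` additional states. -/
def augmentedB {n r : ℕ} (k : ℕ) (B : Matrix (Fin n) (Fin r) ℝ) :
    Matrix (Fin n ⊕ Fin k) (Fin r) ℝ :=
  fromRows B 0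

/-- `(x, q, ξ)` solves, on `[t₀, ∞)`, the closed loop consisting of
* the plant `ẋ = A x + B u + E w`, `z = D x`, `y = H x + F w` with constant disturbance `w`,
* the PI-regulator `q̇ = z - z_r`, `u = K₁ x̂ + K₂ q` with constant reference `z_r`,
* the full-order observer of `(x, w)`, with state `ξ = (x̂, ŵ)`,
  `ξ̇ = [A E; 0 0] ξ + [B; 0] u + L (y - [H F] ξ)`. -/
structure IsClosedLoopSolution {n r d p l : ℕ}
    (A : Matrix (Fin n) (Fin n) ℝ) (B : Matrix (Fin n) (Fin r) ℝ)
    (E : Matrix (Fin n) (Fin p) ℝ) (D : Matrix (Fin d) (Fin n) ℝ)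
    (H : Matrix (Fin l) (Fin n) ℝ) (F : Matrix (Fin l) (Fin p) ℝ)
    (K₁ : Matrix (Fin r) (Fin n) ℝ) (K₂ : Matrix (Fin r) (Fin d) ℝ)
    (L : Matrix (Fin n ⊕ Fin p) (Fin l) ℝ)
    (w : Fin p → ℝ) (zr : Fin d → ℝ) (t₀ : ℝ)
    (x : ℝ → Fin n → ℝ) (q : ℝ → Fin d → ℝ) (ξ : ℝ → Fin n ⊕ Fin p → ℝ)
    (u : ℝ → Fin r → ℝ) (y : ℝ → Fin l → ℝ) (z : ℝ → Fin d → ℝ) : Prop where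
  plant : ∀ t ∈ Set.Ici t₀,
    HasDerivWithinAt x (A *ᵥ x t + B *ᵥ u t + E *ᵥ w) (Set.Ici t₀) t
  regulated : ∀ t ∈ Set.Ici t₀, z t = D *ᵥ x t
  measured : ∀ t ∈ Set.Ici t₀, y t = H *ᵥ x t + F *ᵥ w
  integrator : ∀ t ∈ Set.Ici t₀, HasDerivWithinAt q (z t - zr) (Set.Ici t₀) t
  control : ∀ t ∈ Set.Ici t₀, u t = K₁ *ᵥ (fun i => ξ t (Sum.inl i)) + K₂ *ᵥ q t
  observer : ∀ t ∈ Set.Ici t₀,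
    HasDerivWithinAt ξ
      (disturbanceA A E *ᵥ ξ t + augmentedB p B *ᵥ u t + L *ᵥ (y t - fromCols H F *ᵥ ξ t))
      (Set.Ici t₀) t

/-- The dynamics matrix of the closed loop in the coordinates `((x, q), ε)`, where
`ε = (x, w) - (x̂, ŵ)` is the observer error, so that `x̂ = x - [I 0] ε`. -/
def closedLoopMatrix {n r d p l : ℕ}
    (A : Matrix (Fin n) (Fin n) ℝ) (B : Matrix (Fin n) (Fin r) ℝ)
    (E : Matrix (Fin n) (Fin p) ℝ) (D : Matrix (Fin d) (Fin n) ℝ)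
    (H : Matrix (Fin l) (Fin n) ℝ) (F : Matrix (Fin l) (Fin p) ℝ)
    (K₁ : Matrix (Fin r) (Fin n) ℝ) (K₂ : Matrix (Fin r) (Fin d) ℝ)
    (L : Matrix (Fin n ⊕ Fin p) (Fin l) ℝ) :
    Matrix ((Fin n ⊕ Fin d) ⊕ (Fin n ⊕ Fin p)) ((Fin n ⊕ Fin d) ⊕ (Fin n ⊕ Fin p)) ℝ :=
  fromBlocks
    (fromBlocks (A + B * K₁) (B * K₂) D 0)
    (fromRows (-(B * fromCols K₁ 0)) 0)
    0
    (disturbanceA A E - L * fromCols H F)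

/-- The observer-based PI-regulator with gains `K₁, K₂, L` solves the tracking problem: the closed
loop is asymptotically stable, and `z(t) → z_r` for all constant disturbances, all constant
references and all initial conditions. -/
structure IsTrackingPIRegulator {n r d p l : ℕ}
    (A : Matrix (Fin n) (Fin n) ℝ) (B : Matrix (Fin n) (Fin r) ℝ)
    (E : Matrix (Fin n) (Fin p) ℝ) (D : Matrix (Fin d) (Fin n) ℝ)
    (H : Matrix (Fin l) (Fin n) ℝ) (F : Matrix (Fin l) (Fin p) ℝ)
    (K₁ : Matrix (Fin r) (Fin n) ℝ) (K₂ : Matrix (Fin r) (Fin d) ℝ)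
    (L : Matrix (Fin n ⊕ Fin p) (Fin l) ℝ) : Prop where
  stable : IsHurwitz (closedLoopMatrix A B E D H F K₁ K₂ L)
  tracks : ∀ (w : Fin p → ℝ) (zr : Fin d → ℝ) (t₀ : ℝ)
    (x : ℝ → Fin n → ℝ) (q : ℝ → Fin d → ℝ) (ξ : ℝ → Fin n ⊕ Fin p → ℝ)
    (u : ℝ → Fin r → ℝ) (y : ℝ → Fin l → ℝ) (z : ℝ → Fin d → ℝ),
    IsClosedLoopSolution A B E D H F K₁ K₂ L w zr t₀ x q ξ u y z →
      Tendsto z atTop (𝓝 zr)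

end

/-!
The closed loop matrix is block triangular, so it can be stabilized exactly when the integrator
augmented pair is stabilizable and the disturbance augmented pair is detectable (separation
principle, `exists_isHurwitz_closedLoopMatrix_iff`). Detectability is stabilizability of the
transposed pair, so both conditions are instances of one statement,
`isStabilizable_integratorA_iff`, about adding integrators to a system.

That statement follows from the Hautus test `isStabilizable_iff_hautusCondition`: a pair `(A, B)`
is stabilizable iff no left eigenvector of `A` for an eigenvalue in the closed right half-plane
annihilates `B`. Integrators add only the eigenvalue `0`, and there the Hautus condition says that
the system matrix at `0` has trivial left kernel, i.e. full row rank.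

The nontrivial half of the Hautus test is proved by induction on the number of unstable
eigenvalues, counted with multiplicity (`unstableCount`). A real feedback that acts only on the
left-invariant subspace of one real eigenvalue, or of one pair of nonreal eigenvalues, replaces
these eigenvalues by `-1` and leaves the rest of the characteristic polynomial unchanged
(`charpoly_add_mul_mul_charpoly`), while the Hautus condition is invariant under feedback.

Tracking is automatic once the closed loop is stable. The solutions satisfy `ẏ = M y + b` with `M`
stable, hence tend to an equilibrium, and the integrator equation at the equilibrium reads
`z = zr`. Convergence is obtained without matrix exponentials: by Cayley–Hamilton the factors
`M - c` of the characteristic polynomial annihilate the deviation from the equilibrium, and each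
factor is removed by a scalar variation of constants argument
(`tendsto_zero_of_aeval_prod_mulVec_eq_zero`).
-/

/-! ### Stability and left eigenvectors -/

/-- A real matrix is stable exactly when every complex left eigenvector belongs to an eigenvalue
with negative real part. -/
theorem isHurwitz_iff_left_eigenvector {ι : Type*} [Fintype ι] [DecidableEq ι]
    (M : Matrix ι ι ℝ) :
    IsHurwitz M ↔ ∀ (μ : ℂ) (v : ι → ℂ), v ≠ 0 →
      v ᵥ* M.map (algebraMap ℝ ℂ) = μ • v → μ.re < 0 := by
  have key (μ : ℂ) : μ ∈ spectrum ℂ (M.map (algebraMap ℝ ℂ)) ↔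
      ∃ v : ι → ℂ, v ≠ 0 ∧ v ᵥ* M.map (algebraMap ℝ ℂ) = μ • v := by
    rw [spectrum.mem_iff, Matrix.isUnit_iff_isUnit_det, isUnit_iff_ne_zero, not_not,
      ← Matrix.exists_vecMul_eq_zero_iff]
    refine exists_congr fun v => and_congr_right fun _ => ?_
    rw [Matrix.vecMul_sub, Algebra.algebraMap_eq_smul_one, Matrix.vecMul_smul, Matrix.vecMul_one,
      sub_eq_zero, eq_comm]
  constructor
  · intro h μ v hv hvM
    exact h μ ((key μ).2 ⟨v, hv, hvM⟩)
  · intro h μ hμ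
    obtain ⟨v, hv, hvM⟩ := (key μ).1 hμ
    exact h μ v hv hvM

theorem isHurwitz_iff_charpoly_roots {ι : Type*} [Fintype ι] [DecidableEq ι]
    (M : Matrix ι ι ℝ) :
    IsHurwitz M ↔ ∀ μ ∈ (M.map (algebraMap ℝ ℂ)).charpoly.roots, μ.re < 0 := by
  unfold IsHurwitz
  simp only [Matrix.mem_spectrum_iff_isRoot_charpoly,
    Polynomial.mem_roots (Matrix.charpoly_monic _).ne_zero]

theorem isHurwitz_transpose {ι : Type*} [Fintype ι] [DecidableEq ι] (M : Matrix ι ι ℝ) :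
    IsHurwitz Mᵀ ↔ IsHurwitz M := by
  rw [isHurwitz_iff_charpoly_roots, isHurwitz_iff_charpoly_roots, Matrix.transpose_map,
    Matrix.charpoly_transpose]

theorem isHurwitz_fromBlocks_zero₂₁ {ι κ : Type*} [Fintype ι] [DecidableEq ι] [Fintype κ]
    [DecidableEq κ] (P : Matrix ι ι ℝ) (Q : Matrix ι κ ℝ) (R : Matrix κ κ ℝ) :
    IsHurwitz (fromBlocks P Q 0 R) ↔ IsHurwitz P ∧ IsHurwitz R := by
  simp only [isHurwitz_iff_charpoly_roots, Matrix.fromBlocks_map,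
    Matrix.map_zero _ (map_zero (algebraMap ℝ ℂ)), Matrix.charpoly_fromBlocks_zero₂₁]
  rw [Polynomial.roots_mul
    (mul_ne_zero (Matrix.charpoly_monic _).ne_zero (Matrix.charpoly_monic _).ne_zero)]
  simp only [Multiset.mem_add, or_imp, forall_and]

theorem isDetectable_iff_isStabilizable_transpose {ι κ : Type*} [Fintype ι] [DecidableEq ι]
    [Fintype κ] (A : Matrix ι ι ℝ) (H : Matrix κ ι ℝ) :
    IsDetectable A H ↔ IsStabilizable Aᵀ Hᵀ := by
  constructor
  · rintro ⟨L, hL⟩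
    refine ⟨-Lᵀ, ?_⟩
    rw [← isHurwitz_transpose]
    simpa [sub_eq_add_neg] using hL
  · rintro ⟨K, hK⟩
    refine ⟨-Kᵀ, ?_⟩
    rw [← isHurwitz_transpose]
    simpa [sub_eq_add_neg] using hK

/-! ### The Hautus test -/

/-- The Hautus (Popov–Belevitch–Hautus) condition: no complex left eigenvector of `A` belonging to
an eigenvalue in the closed right half-plane annihilates `B`. -/
def HautusCondition {ι κ : Type*} [Fintype ι] (A : Matrix ι ι ℝ) (B : Matrix ι κ ℝ) : Prop :=
  ∀ (μ : ℂ) (v : ι → ℂ), 0 ≤ μ.re → v ᵥ* A.map (algebraMap ℝ ℂ) = μ • v →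
    v ᵥ* B.map (algebraMap ℝ ℂ) = 0 → v = 0

theorem HautusCondition.add_mul {ι κ : Type*} [Fintype ι] [Fintype κ]
    {A : Matrix ι ι ℝ} {B : Matrix ι κ ℝ} (h : HautusCondition A B) (K : Matrix κ ι ℝ) :
    HautusCondition (A + B * K) B := by
  intro μ v hμ hA hB
  refine h μ v hμ ?_ hB
  rw [Matrix.map_add _ (map_add _), Matrix.map_mul, Matrix.vecMul_add, ← Matrix.vecMul_vecMul,
    hB, Matrix.zero_vecMul, add_zero] at hA
  exact hA

theorem IsStabilizable.hautusCondition {ι κ : Type*} [Fintype ι] [DecidableEq ι] [Fintype κ]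
    {A : Matrix ι ι ℝ} {B : Matrix ι κ ℝ} (h : IsStabilizable A B) : HautusCondition A B := by
  obtain ⟨K, hK⟩ := h
  intro μ v hμ hA hB
  by_contra hv
  refine absurd ((isHurwitz_iff_left_eigenvector _).1 hK μ v hv ?_) (not_lt.2 hμ)
  rw [Matrix.map_add _ (map_add _), Matrix.map_mul, Matrix.vecMul_add, ← Matrix.vecMul_vecMul,
    hB, Matrix.zero_vecMul, add_zero, hA]

/-- If the rows of `F` span a left-invariant subspace, `F * A = Λ * F`, then the perturbation
`A + G * F` changes the spectrum on that subspace only, where it replaces `Λ` by `Λ + F * G`.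
The reason is that the unipotent matrix `[1 0; F 1]` conjugates `[A + G F, -G; 0, Λ]` into
`[A, -G; 0, Λ + F G]`. -/
theorem charpoly_add_mul_mul_charpoly {R ι κ : Type*} [CommRing R] [Fintype ι] [DecidableEq ι]
    [Fintype κ] [DecidableEq κ] {A : Matrix ι ι R} {F : Matrix κ ι R} {Λ : Matrix κ κ R}
    (h : F * A = Λ * F) (G : Matrix ι κ R) :
    (A + G * F).charpoly * Λ.charpoly = A.charpoly * (Λ + F * G).charpoly := by
  rw [← Matrix.charpoly_fromBlocks_zero₂₁ _ (-G) _, ← Matrix.charpoly_fromBlocks_zero₂₁ _ (-G) _]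
  have hT : ∀ S : Matrix κ ι R, fromBlocks (1 : Matrix ι ι R) 0 S (1 : Matrix κ κ R) *
      fromBlocks 1 0 (-S) 1 = 1 := by
    intro S
    simp [Matrix.fromBlocks_multiply]
  let T : (Matrix (ι ⊕ κ) (ι ⊕ κ) R)ˣ :=
    ⟨fromBlocks 1 0 F 1, fromBlocks 1 0 (-F) 1, hT F, by simpa using hT (-F)⟩
  rw [← Matrix.charpoly_units_conj' T]
  congr 1
  rw [← Matrix.coe_units_inv]
  change fromBlocks 1 0 (-F) 1 * fromBlocks (A + G * F) (-G) 0 Λ * fromBlocks 1 0 F 1 = _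
  simp only [Matrix.fromBlocks_multiply]
  congr 1
  · simp
  · simp
  · simp only [Matrix.mul_add, Matrix.one_mul, Matrix.mul_zero, add_zero, Matrix.mul_one,
      Matrix.mul_neg, Matrix.add_mul, h, Matrix.neg_mul, Matrix.mul_assoc]
    abel
  · simp [add_comm]

/-- The number of eigenvalues in the closed right half-plane, with algebraic multiplicity. -/
noncomputable def unstableCount {ι : Type*} [Fintype ι] [DecidableEq ι] (M : Matrix ι ι ℝ) : ℕ :=
  (M.map (algebraMap ℝ ℂ)).charpoly.roots.countP (fun μ => 0 ≤ μ.re)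

theorem unstableCount_eq_zero_iff {ι : Type*} [Fintype ι] [DecidableEq ι] (M : Matrix ι ι ℝ) :
    unstableCount M = 0 ↔ IsHurwitz M := by
  rw [isHurwitz_iff_charpoly_roots, unstableCount, Multiset.countP_eq_zero]
  simp only [not_le]

theorem unstableCount_add_mul {ι κ : Type*} [Fintype ι] [DecidableEq ι]
    [Fintype κ] [DecidableEq κ] {A : Matrix ι ι ℝ} {F : Matrix κ ι ℝ} {Λ : Matrix κ κ ℝ}
    (h : F * A = Λ * F) (G : Matrix ι κ ℝ) :
    unstableCount (A + G * F) + unstableCount Λ = unstableCount A + unstableCount (Λ + F * G) := by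
  have h' : F.map (algebraMap ℝ ℂ) * A.map (algebraMap ℝ ℂ) =
      Λ.map (algebraMap ℝ ℂ) * F.map (algebraMap ℝ ℂ) := by
    rw [← Matrix.map_mul, ← Matrix.map_mul, h]
  have e := congrArg Polynomial.roots
    (charpoly_add_mul_mul_charpoly h' (G.map (algebraMap ℝ ℂ)))
  rw [Polynomial.roots_mul
    (mul_ne_zero (Matrix.charpoly_monic _).ne_zero (Matrix.charpoly_monic _).ne_zero),
    Polynomial.roots_mul
    (mul_ne_zero (Matrix.charpoly_monic _).ne_zero (Matrix.charpoly_monic _).ne_zero),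
    ← Matrix.map_mul, ← Matrix.map_mul, ← Matrix.map_add _ (map_add _),
    ← Matrix.map_add _ (map_add _)] at e
  unfold unstableCount
  rw [← Multiset.countP_add, e, Multiset.countP_add]

/-- A feedback through one input that acts only on the left-invariant subspace spanned by the rows
of `F` lowers the number of unstable eigenvalues, provided that it stabilizes an unstable `Λ`. -/
theorem exists_unstableCount_add_mul_lt {ι κ η : Type*} [Fintype ι] [DecidableEq ι] [Fintype κ]
    [DecidableEq κ] [Fintype η] [DecidableEq η] {A : Matrix ι ι ℝ} {B : Matrix ι κ ℝ}
    {F : Matrix η ι ℝ} {Λ : Matrix η η ℝ} (h : F * A = Λ * F) (hB : F * B ≠ 0)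
    (hΛ : ¬ IsHurwitz Λ)
    (hstab : ∀ β : η → ℝ, β ≠ 0 → ∃ k : η → ℝ, IsHurwitz (Λ + vecMulVec β k)) :
    ∃ K : Matrix κ ι ℝ, unstableCount (A + B * K) < unstableCount A := by
  obtain ⟨j, hj⟩ : ∃ j, (F * B).col j ≠ 0 := by
    by_contra! hcon
    exact hB (Matrix.ext fun i j => congrFun (hcon j) i)
  obtain ⟨k, hk⟩ := hstab _ hj
  refine ⟨vecMulVec (Pi.single j 1) k * F, ?_⟩
  have e := unstableCount_add_mul h (B * vecMulVec (Pi.single j 1) k)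
  rw [← Matrix.mul_assoc F B, Matrix.mul_vecMulVec (F * B), Matrix.mulVec_single_one,
    (unstableCount_eq_zero_iff _).2 hk, Matrix.mul_assoc] at e
  have := Nat.pos_of_ne_zero (mt (unstableCount_eq_zero_iff Λ).1 hΛ)
  omega

theorem exists_isHurwitz_add_vecMulVec_fin_one (σ : ℝ) (β : Fin 1 → ℝ) (hβ : β ≠ 0) :
    ∃ k : Fin 1 → ℝ, IsHurwitz (!![σ] + vecMulVec β k) := by
  have h0 : β 0 ≠ 0 := fun h => hβ (funext fun i => by rw [Subsingleton.elim i 0, h]; rfl)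
  refine ⟨fun _ => (-1 - σ) / β 0, (isHurwitz_iff_left_eigenvector _).2 fun μ v hv h => ?_⟩
  have hv0 : v 0 ≠ 0 := fun h => hv (funext fun i => by rw [Subsingleton.elim i 0, h]; rfl)
  have e := congrFun h 0
  have e2 : σ + β 0 * ((-1 - σ) / β 0) = -1 := by field_simp; ring
  simp only [vecMul, dotProduct, Fin.sum_univ_one, Matrix.map_apply, Matrix.add_apply,
    vecMulVec_apply, Matrix.of_apply, Pi.smul_apply, smul_eq_mul,
    Matrix.cons_val', Matrix.cons_val_fin_one] at e
  rw [e2, mul_comm] at e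
  have := mul_right_cancel₀ hv0 e
  rw [← this]
  simp

/-- The `2 × 2` real form of a nonreal eigenvalue pair `σ ± ω i` can be moved to the double
eigenvalue `-1` through any nonzero input direction. -/
theorem exists_isHurwitz_add_vecMulVec_fin_two (σ ω : ℝ) (hω : ω ≠ 0) (β : Fin 2 → ℝ)
    (hβ : β ≠ 0) :
    ∃ k : Fin 2 → ℝ, IsHurwitz (!![σ, -ω; ω, σ] + vecMulVec β k) := by
  have hN : β 0 ^ 2 + β 1 ^ 2 ≠ 0 := by
    intro h
    apply hβ
    funext i
    fin_cases i
    · simpa using (show β 0 = 0 by nlinarith [sq_nonneg (β 0), sq_nonneg (β 1)])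
    · simpa using (show β 1 = 0 by nlinarith [sq_nonneg (β 0), sq_nonneg (β 1)])
  -- `k` solves two linear equations: the trace becomes `-2` and the determinant becomes `1`.
  -- In `a = β 0 * k 0 + β 1 * k 1` and `b = β 1 * k 0 - β 0 * k 1` these read
  -- `2 σ + a = -2` and `σ² + ω² + σ a + ω b = 1`, which is where `ω ≠ 0` is needed.
  obtain ⟨a, ha⟩ : ∃ a, a = -2 - 2 * σ := ⟨_, rfl⟩
  obtain ⟨b, hb⟩ : ∃ b, b = (1 - σ ^ 2 - ω ^ 2 - σ * a) / ω := ⟨_, rfl⟩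
  have hb' : ω * b = 1 - σ ^ 2 - ω ^ 2 - σ * a := by rw [hb]; field_simp
  obtain ⟨k0, hk0⟩ : ∃ k0, k0 = (β 0 * a + β 1 * b) / (β 0 ^ 2 + β 1 ^ 2) := ⟨_, rfl⟩
  obtain ⟨k1, hk1⟩ : ∃ k1, k1 = (β 1 * a - β 0 * b) / (β 0 ^ 2 + β 1 ^ 2) := ⟨_, rfl⟩
  have h1 : β 0 * k0 + β 1 * k1 = a := by rw [hk0, hk1]; field_simp; ring
  have h2 : β 1 * k0 - β 0 * k1 = b := by rw [hk0, hk1]; field_simp; ring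
  refine ⟨![k0, k1], ?_⟩
  rw [isHurwitz_iff_charpoly_roots]
  intro μ hμ
  have hM : !![σ, -ω; ω, σ] + vecMulVec β ![k0, k1] =
      !![σ + β 0 * k0, -ω + β 0 * k1; ω + β 1 * k0, σ + β 1 * k1] := by
    ext i j
    fin_cases i <;> fin_cases j <;> simp
  rw [Polynomial.mem_roots (Matrix.charpoly_monic _).ne_zero, Matrix.charpoly_fin_two, hM] at hμ
  have ht : (σ + β 0 * k0) + (σ + β 1 * k1) = -2 := by rw [ha] at h1; linarith
  have hd : (σ + β 0 * k0) * (σ + β 1 * k1) - (-ω + β 0 * k1) * (ω + β 1 * k0) = 1 := by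
    linear_combination σ * h1 + ω * h2 + hb'
  have ht' := congrArg (algebraMap ℝ ℂ) ht
  have hd' := congrArg (algebraMap ℝ ℂ) hd
  simp [Matrix.trace_fin_two, Matrix.det_fin_two, Polynomial.IsRoot] at hμ ht' hd'
  have : (μ + 1) ^ 2 = 0 := by linear_combination hμ + μ * ht' - hd'
  have := pow_eq_zero_iff (two_ne_zero) |>.1 this
  rw [eq_neg_of_add_eq_zero_left this]
  simp

theorem re_vecMul_map {ι κ : Type*} [Fintype ι] (v : ι → ℂ) (M : Matrix ι κ ℝ) (j : κ) :
    ((v ᵥ* M.map (algebraMap ℝ ℂ)) j).re = ((fun i => (v i).re) ᵥ* M) j := by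
  simp [vecMul, dotProduct]

theorem im_vecMul_map {ι κ : Type*} [Fintype ι] (v : ι → ℂ) (M : Matrix ι κ ℝ) (j : κ) :
    ((v ᵥ* M.map (algebraMap ℝ ℂ)) j).im = ((fun i => (v i).im) ᵥ* M) j := by
  simp [vecMul, dotProduct]

/-- One step of the construction of a stabilizing feedback: a real unstable eigenvalue or a pair of
nonreal unstable eigenvalues is moved to `-1`. -/
theorem HautusCondition.exists_unstableCount_lt {ι κ : Type*} [Fintype ι] [DecidableEq ι]
    [Fintype κ] [DecidableEq κ] {A : Matrix ι ι ℝ} {B : Matrix ι κ ℝ}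
    (h : HautusCondition A B) (hA : ¬ IsHurwitz A) :
    ∃ K : Matrix κ ι ℝ, unstableCount (A + B * K) < unstableCount A := by
  simp only [isHurwitz_iff_left_eigenvector, not_forall, not_lt] at hA
  obtain ⟨μ, v, hv, hvA, hμ⟩ := hA
  have hvB : v ᵥ* B.map (algebraMap ℝ ℂ) ≠ 0 := fun h0 => hv (h μ v hμ hvA h0)
  have hre : (fun i => (v i).re) ᵥ* A =
      μ.re • (fun i => (v i).re) - μ.im • (fun i => (v i).im) := by
    funext j
    rw [← re_vecMul_map, hvA]
    simp
  have him : (fun i => (v i).im) ᵥ* A =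
      μ.re • (fun i => (v i).im) + μ.im • (fun i => (v i).re) := by
    funext j
    rw [← im_vecMul_map, hvA]
    simp
  have hB : (fun i => (v i).re) ᵥ* B ≠ 0 ∨ (fun i => (v i).im) ᵥ* B ≠ 0 := by
    by_contra! hcon
    apply hvB
    funext j
    apply Complex.ext
    · rw [re_vecMul_map, hcon.1]; rfl
    · rw [im_vecMul_map, hcon.2]; rfl
  by_cases hω : μ.im = 0
  · obtain ⟨f, hfA, hfB⟩ : ∃ f : ι → ℝ, f ᵥ* A = μ.re • f ∧ f ᵥ* B ≠ 0 := by
      rcases hB with hB | hB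
      · exact ⟨_, by simpa [hω] using hre, hB⟩
      · exact ⟨_, by simpa [hω] using him, hB⟩
    refine exists_unstableCount_add_mul_lt (F := Matrix.of ![f]) (Λ := !![μ.re]) ?_ ?_ ?_
      (exists_isHurwitz_add_vecMulVec_fin_one μ.re)
    · ext i j
      rw [Subsingleton.elim i 0, Matrix.mul_apply_eq_vecMul, Matrix.mul_apply_eq_vecMul]
      have := congrFun hfA j
      simpa [vecMul, dotProduct, Matrix.row] using this
    · intro h0
      apply hfB
      funext j
      have := congrFun (congrFun h0 0) j
      simpa [Matrix.mul_apply, vecMul, dotProduct] using this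
    · rw [isHurwitz_iff_left_eigenvector]
      intro hH
      refine absurd (hH μ.re (fun _ => 1) ?_ ?_) (by simpa using hμ)
      · exact fun h0 => one_ne_zero (congrFun h0 0)
      · funext i
        rw [Subsingleton.elim i 0]
        simp [vecMul, dotProduct]
  · refine exists_unstableCount_add_mul_lt
      (F := Matrix.of ![fun i => (v i).re, fun i => (v i).im])
      (Λ := !![μ.re, -μ.im; μ.im, μ.re]) ?_ ?_ ?_
      (exists_isHurwitz_add_vecMulVec_fin_two μ.re μ.im hω)
    · ext i j
      have h1 := congrFun hre j
      have h2 := congrFun him j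
      simp only [vecMul, dotProduct, Pi.sub_apply, Pi.add_apply, Pi.smul_apply, smul_eq_mul]
        at h1 h2
      fin_cases i
      · simp [Matrix.mul_apply, h1, sub_eq_add_neg]
      · simp [Matrix.mul_apply, h2, add_comm]
    · intro h0
      rcases hB with hB | hB
      · refine hB (funext fun j => ?_)
        have := congrFun (congrFun h0 0) j
        simpa [Matrix.mul_apply, vecMul, dotProduct] using this
      · refine hB (funext fun j => ?_)
        have := congrFun (congrFun h0 1) j
        simpa [Matrix.mul_apply, vecMul, dotProduct] using this
    · rw [isHurwitz_iff_charpoly_roots]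
      intro hH
      refine absurd (hH μ ?_) (not_lt.2 hμ)
      rw [Polynomial.mem_roots (Matrix.charpoly_monic _).ne_zero, Matrix.charpoly_fin_two]
      have e : (μ.re : ℂ) + μ.im * Complex.I = μ := Complex.re_add_im μ
      simp only [Polynomial.IsRoot, Matrix.trace_fin_two, Matrix.det_fin_two, Matrix.map_apply]
      simp
      linear_combination (μ - μ.re + μ.im * Complex.I) * (-e) + (μ.im : ℂ) ^ 2 * Complex.I_sq

theorem HautusCondition.isStabilizable {ι κ : Type*} [Fintype ι] [DecidableEq ι] [Fintype κ]
    {A : Matrix ι ι ℝ} {B : Matrix ι κ ℝ} (h : HautusCondition A B) : IsStabilizable A B := by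
  classical
  induction hc : unstableCount A using Nat.strong_induction_on generalizing A with
  | _ c ih =>
    by_cases hA : IsHurwitz A
    · exact ⟨0, by simpa using hA⟩
    · obtain ⟨K, hK⟩ := h.exists_unstableCount_lt hA
      obtain ⟨K', hK'⟩ := ih _ (hc ▸ hK) (h.add_mul K) rfl
      exact ⟨K + K', by rwa [Matrix.mul_add, ← add_assoc]⟩

/-- The Hautus test for stabilizability. -/
theorem isStabilizable_iff_hautusCondition {ι κ : Type*} [Fintype ι] [DecidableEq ι] [Fintype κ]
    (A : Matrix ι ι ℝ) (B : Matrix ι κ ℝ) : IsStabilizable A B ↔ HautusCondition A B :=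
  ⟨IsStabilizable.hautusCondition, HautusCondition.isStabilizable⟩

/-! ### Decay of solutions of stable linear systems -/

/-- A stable scalar rate driven by a vanishing input gives a vanishing state. -/
theorem tendsto_zero_of_hasDerivWithinAt_smul_add {V : Type*} [NormedAddCommGroup V]
    [NormedSpace ℂ V] {c : ℂ} (hc : c.re < 0) {t₀ : ℝ} {y g : ℝ → V}
    (hy : ∀ t ∈ Set.Ici t₀, HasDerivWithinAt y (c • y t + g t) (Set.Ici t₀) t)
    (hg : Tendsto g atTop (𝓝 0)) : Tendsto y atTop (𝓝 0) := by
  set a : ℝ := -c.re with ha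
  have ha0 : 0 < a := by simpa [ha] using hc
  rw [Metric.tendsto_atTop]
  intro ε hε
  obtain ⟨T₁, hT₁⟩ := (Metric.tendsto_atTop.1 hg) (ε / 2 * a) (by positivity)
  set T := max T₁ t₀ with hT
  -- Variation of constants: `w` is the state with the free motion divided out.
  have hw : ∀ t ∈ Set.Ici T, HasDerivWithinAt
      (fun s : ℝ => Complex.exp (-c * ((s - T : ℝ) : ℂ)) • y s)
      (Complex.exp (-c * ((t - T : ℝ) : ℂ)) • g t) (Set.Ici T) t := by
    intro t ht
    have hlin : HasDerivAt (fun s : ℝ => -c * ((s - T : ℝ) : ℂ)) (-c * ((1 : ℝ) : ℂ)) t :=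
      (((hasDerivAt_id t).sub_const T).ofReal_comp).const_mul (-c)
    have h1 := hlin.cexp
    have h2 := (hy t (le_trans (le_max_right T₁ t₀) (Set.mem_Ici.1 ht))).mono
      (Set.Ici_subset_Ici.2 (le_max_right T₁ t₀))
    refine (h1.hasDerivWithinAt.fun_smul h2).congr_deriv ?_
    rw [smul_add, smul_smul, add_right_comm, ← add_smul]
    simp
  have hexp (t : ℝ) : ‖Complex.exp (-c * ((t - T : ℝ) : ℂ))‖ = Real.exp (a * (t - T)) := by
    rw [Complex.norm_exp]
    congr 1
    simp [ha]
  have hbound (t : ℝ) (ht : T ≤ t) :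
      Real.exp (a * (t - T)) * ‖y t‖ ≤ ‖y T‖ + ε / 2 * (Real.exp (a * (t - T)) - 1) := by
    have hB : ∀ s : ℝ, HasDerivAt (fun s => ‖y T‖ + ε / 2 * (Real.exp (a * (s - T)) - 1))
        (ε / 2 * (Real.exp (a * (s - T)) * a)) s := by
      intro s
      have h1 : HasDerivAt (fun s : ℝ => a * (s - T)) a s := by
        simpa using ((hasDerivAt_id s).sub_const T).const_mul a
      exact ((h1.exp.sub_const 1).const_mul (ε / 2)).const_add _
    have := image_norm_le_of_norm_deriv_right_le_deriv_boundary (a := T) (b := t)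
      (fun s hs => ((hw s hs.1).continuousWithinAt).mono fun _ h => h.1)
      (fun s hs => (hw s hs.1).mono (Set.Ici_subset_Ici.2 hs.1))
      (by simp) hB
      (fun s hs => by
        rw [norm_smul, hexp]
        have := hT₁ s (le_trans (le_max_left _ _) hs.1)
        rw [dist_zero_right] at this
        nlinarith [Real.exp_pos (a * (s - T))])
      (Set.right_mem_Icc.2 ht)
    rwa [norm_smul, hexp] at this
  have hdecay : Tendsto (fun t : ℝ => Real.exp (-(a * (t - T))) * ‖y T‖) atTop (𝓝 0) := by
    have : Tendsto (fun t : ℝ => a * (t - T)) atTop atTop :=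
      (tendsto_atTop_add_const_right _ (-T) tendsto_id).const_mul_atTop ha0
    simpa using (Real.tendsto_exp_neg_atTop_nhds_zero.comp this).mul_const ‖y T‖
  obtain ⟨T₂, hT₂⟩ := (Metric.tendsto_atTop.1 hdecay) (ε / 2) (by positivity)
  refine ⟨max T T₂, fun t ht => ?_⟩
  have h1 := hbound t (le_trans (le_max_left _ _) ht)
  have h2 := hT₂ t (le_trans (le_max_right _ _) ht)
  rw [dist_zero_right, Real.norm_of_nonneg (by positivity)] at h2
  rw [dist_zero_right]
  have hE := Real.exp_pos (a * (t - T))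
  have h3 : ‖y T‖ = Real.exp (a * (t - T)) * (Real.exp (-(a * (t - T))) * ‖y T‖) := by
    rw [← mul_assoc, ← Real.exp_add]; simp
  have h4 : Real.exp (a * (t - T)) * ‖y t‖ < Real.exp (a * (t - T)) * ε := by
    calc _ ≤ _ := h1
      _ < _ := by nlinarith
  exact lt_of_mul_lt_mul_left h4 hE.le

theorem HasDerivWithinAt.mulVec {𝕜 ι κ : Type*} [RCLike 𝕜] [Fintype ι] [Fintype κ]
    (M : Matrix κ ι 𝕜) {y : ℝ → ι → 𝕜} {y' : ι → 𝕜} {s : Set ℝ} {t : ℝ}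
    (h : HasDerivWithinAt y y' s t) : HasDerivWithinAt (fun t => M *ᵥ y t) (M *ᵥ y') s t := by
  rw [hasDerivWithinAt_pi] at h ⊢
  intro i
  simp only [Matrix.mulVec, dotProduct]
  exact HasDerivWithinAt.fun_sum fun j _ => (h j).const_mul (M i j)

open Polynomial in
/-- A solution of `ẏ = M y` annihilated by `∏ (M - c)`, with all `c` in the open left half-plane,
decays: `g = (M - c) y` is a solution annihilated by the remaining factors, and
`ẏ = c y + g`. -/
theorem tendsto_zero_of_aeval_prod_mulVec_eq_zero {ι : Type*} [Fintype ι] [DecidableEq ι]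
    (M : Matrix ι ι ℂ) {t₀ : ℝ} (m : Multiset ℂ) (hm : ∀ c ∈ m, c.re < 0) (y : ℝ → ι → ℂ)
    (hy : ∀ t ∈ Set.Ici t₀, HasDerivWithinAt y (M *ᵥ y t) (Set.Ici t₀) t)
    (h0 : ∀ t ∈ Set.Ici t₀, aeval M (m.map fun c => X - C c).prod *ᵥ y t = 0) :
    Tendsto y atTop (𝓝 0) := by
  induction m using Multiset.induction_on generalizing y with
  | empty =>
    refine tendsto_const_nhds.congr' ?_
    filter_upwards [eventually_ge_atTop t₀] with t ht
    simpa using (h0 t ht).symm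
  | cons c m ih =>
    have hg : Tendsto (fun t => (M - algebraMap ℂ _ c) *ᵥ y t) atTop (𝓝 0) := by
      refine ih (fun c' hc' => hm c' (Multiset.mem_cons_of_mem hc')) _ (fun t ht => ?_)
        (fun t ht => ?_)
      · have := (hy t ht).mulVec (M - algebraMap ℂ _ c)
        rw [Matrix.mulVec_mulVec] at this ⊢
        rwa [sub_mul, Algebra.commutes, ← mul_sub] at this
      · have := h0 t ht
        rw [Multiset.map_cons, Multiset.prod_cons, mul_comm, map_mul, map_sub, aeval_X,
          aeval_C] at this
        rwa [Matrix.mulVec_mulVec]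
    refine tendsto_zero_of_hasDerivWithinAt_smul_add (t₀ := t₀)
      (hm c (Multiset.mem_cons_self c m))
      (fun t ht => ?_) hg
    refine (hy t ht).congr_deriv ?_
    rw [Matrix.sub_mulVec, Algebra.algebraMap_eq_smul_one, Matrix.smul_mulVec, Matrix.one_mulVec]
    abel

/-- Solutions of a stable homogeneous linear system tend to zero. -/
theorem IsHurwitz.tendsto_zero {ι : Type*} [Fintype ι] [DecidableEq ι] {M : Matrix ι ι ℝ}
    (hM : IsHurwitz M) {t₀ : ℝ} {y : ℝ → ι → ℝ}
    (hy : ∀ t ∈ Set.Ici t₀, HasDerivWithinAt y (M *ᵥ y t) (Set.Ici t₀) t) :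
    Tendsto y atTop (𝓝 0) := by
  have hC : Tendsto (fun t i => (y t i : ℂ)) atTop (𝓝 0) := by
    refine tendsto_zero_of_aeval_prod_mulVec_eq_zero (M.map (algebraMap ℝ ℂ)) (t₀ := t₀)
      (M.map (algebraMap ℝ ℂ)).charpoly.roots (fun c hc => hM c ?_) _ (fun t ht => ?_)
      (fun t _ => ?_)
    · rwa [Matrix.mem_spectrum_iff_isRoot_charpoly,
        ← Polynomial.mem_roots (Matrix.charpoly_monic _).ne_zero]
    · rw [hasDerivWithinAt_pi]
      intro i
      refine ((hasDerivWithinAt_pi.1 (hy t ht)) i).ofReal_comp.congr_deriv ?_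
      exact RingHom.map_mulVec (algebraMap ℝ ℂ) M (y t) i
    · rw [← (IsAlgClosed.splits _).eq_prod_roots_of_monic (Matrix.charpoly_monic _),
        Matrix.aeval_self_charpoly, Matrix.zero_mulVec]
  rw [tendsto_pi_nhds] at hC ⊢
  intro i
  exact ((Complex.continuous_re.tendsto _).comp (hC i) :)

/-- Solutions of a stable affine system tend to an equilibrium. -/
theorem IsHurwitz.exists_equilibrium {ι : Type*} [Fintype ι] [DecidableEq ι] {M : Matrix ι ι ℝ}
    (hM : IsHurwitz M) (b : ι → ℝ) {t₀ : ℝ} {y : ℝ → ι → ℝ}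
    (hy : ∀ t ∈ Set.Ici t₀, HasDerivWithinAt y (M *ᵥ y t + b) (Set.Ici t₀) t) :
    ∃ e : ι → ℝ, M *ᵥ e + b = 0 ∧ Tendsto y atTop (𝓝 e) := by
  have hdet : IsUnit M.det := by
    rw [isUnit_iff_ne_zero]
    intro h0
    have : (0 : ℂ) ∈ spectrum ℂ (M.map (algebraMap ℝ ℂ)) := by
      have hd : (M.map (algebraMap ℝ ℂ)).det = 0 := by
        rw [← RingHom.mapMatrix_apply, ← RingHom.map_det, h0, map_zero]
      rw [spectrum.zero_mem_iff, Matrix.isUnit_iff_isUnit_det, hd]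
      exact not_isUnit_zero
    exact lt_irrefl _ (hM 0 this)
  have he : M *ᵥ (M⁻¹ *ᵥ -b) = -b := by
    rw [Matrix.mulVec_mulVec, Matrix.mul_nonsing_inv _ hdet, Matrix.one_mulVec]
  refine ⟨M⁻¹ *ᵥ -b, by rw [he]; simp, ?_⟩
  have := hM.tendsto_zero (y := fun t => y t - M⁻¹ *ᵥ -b) (t₀ := t₀) (fun t ht => by
    rw [Matrix.mulVec_sub, he, sub_neg_eq_add]
    exact (hy t ht).sub_const _)
  simpa using this.add_const (M⁻¹ *ᵥ -b)

/-! ### System zeros and the augmented systems -/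

theorem not_isSystemZero_iff_vecMul_injective {n m k : ℕ} (A : Matrix (Fin n) (Fin n) ℝ)
    (B : Matrix (Fin n) (Fin m) ℝ) (C : Matrix (Fin k) (Fin n) ℝ) (G : Matrix (Fin k) (Fin m) ℝ)
    (s : ℂ) :
    k ≤ m ∧ ¬ IsSystemZero A B C G s ↔
      ∀ v, v ᵥ* systemMatrix A B C G s = 0 → v = 0 := by
  have hinj : (∀ v, v ᵥ* systemMatrix A B C G s = 0 → v = 0) ↔
      n + k = (systemMatrix A B C G s).rank := by
    rw [Matrix.rank_eq_finrank_span_row]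
    have := linearIndependent_iff_card_eq_finrank_span (R := ℂ)
      (b := (systemMatrix A B C G s).row)
    rw [Fintype.card_sum, Fintype.card_fin, Fintype.card_fin, Set.finrank] at this
    rw [← this, ← Matrix.vecMul_injective_iff]
    exact (injective_iff_map_eq_zero (systemMatrix A B C G s).vecMulLinear).symm
  have h1 : (systemMatrix A B C G s).rank ≤ n + k := by
    simpa using (systemMatrix A B C G s).rank_le_card_height
  have h2 : (systemMatrix A B C G s).rank ≤ n + m := by
    simpa using (systemMatrix A B C G s).rank_le_card_width
  rw [hinj, IsSystemZero, not_lt]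
  constructor
  · rintro ⟨hkm, h⟩
    rw [min_eq_right hkm] at h
    omega
  · intro h
    have : k ≤ m := by omega
    rw [min_eq_right this]
    omega

/-- The system matrix at `0` of the dual system is, up to signs, the transposed system matrix. -/
theorem isSystemZero_transpose {n m k : ℕ} (A : Matrix (Fin n) (Fin n) ℝ)
    (B : Matrix (Fin n) (Fin m) ℝ) (C : Matrix (Fin k) (Fin n) ℝ) (G : Matrix (Fin k) (Fin m) ℝ) :
    IsSystemZero Aᵀ Cᵀ Bᵀ Gᵀ 0 ↔ IsSystemZero A B C G 0 := by
  have e : systemMatrix Aᵀ Cᵀ Bᵀ Gᵀ 0 =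
      fromBlocks (1 : Matrix (Fin n) (Fin n) ℂ) 0 0 (-1 : Matrix (Fin m) (Fin m) ℂ) *
        (systemMatrix A B C G 0)ᵀ *
        fromBlocks (1 : Matrix (Fin n) (Fin n) ℂ) 0 0 (-1 : Matrix (Fin k) (Fin k) ℂ) := by
    simp [systemMatrix, Matrix.fromBlocks_transpose, Matrix.fromBlocks_multiply,
      Matrix.transpose_map]
  have hu (a b : ℕ) : IsUnit
      (fromBlocks (1 : Matrix (Fin a) (Fin a) ℂ) 0 0 (-1 : Matrix (Fin b) (Fin b) ℂ)).det := by
    rw [Matrix.det_fromBlocks_zero₂₁, Matrix.det_one, one_mul, Matrix.det_neg, Matrix.det_one,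
      mul_one]
    exact (isUnit_one.neg).pow _
  rw [IsSystemZero, IsSystemZero, e, Matrix.rank_mul_eq_left_of_isUnit_det _ _ (hu _ _),
    Matrix.rank_mul_eq_right_of_isUnit_det _ _ (hu _ _), Matrix.rank_transpose, min_comm]

/-- Adding integrators to a stabilizable system: at a nonzero eigenvalue a left eigenvector of the
augmented matrix vanishes on the integrator states, and at the eigenvalue `0` the Hautus condition
says that the system matrix at `0` has trivial left kernel. -/
theorem isStabilizable_integratorA_iff {n m k : ℕ} (A : Matrix (Fin n) (Fin n) ℝ)
    (B : Matrix (Fin n) (Fin m) ℝ) (C : Matrix (Fin k) (Fin n) ℝ)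
    (G : Matrix (Fin k) (Fin m) ℝ) :
    IsStabilizable (integratorA A C) (fromRows B G) ↔
      IsStabilizable A B ∧ k ≤ m ∧ ¬ IsSystemZero A B C G 0 := by
  rw [not_isSystemZero_iff_vecMul_injective, isStabilizable_iff_hautusCondition,
    isStabilizable_iff_hautusCondition]
  have hA (v₁ : Fin n → ℂ) (v₂ : Fin k → ℂ) :
      Sum.elim v₁ v₂ ᵥ* (integratorA A C).map (algebraMap ℝ ℂ) =
        Sum.elim (v₁ ᵥ* A.map (algebraMap ℝ ℂ) + v₂ ᵥ* C.map (algebraMap ℝ ℂ)) 0 := by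
    rw [integratorA, Matrix.fromBlocks_map, Matrix.vecMul_fromBlocks]
    simp
  have hB (v₁ : Fin n → ℂ) (v₂ : Fin k → ℂ) :
      Sum.elim v₁ v₂ ᵥ* (fromRows B G).map (algebraMap ℝ ℂ) =
        v₁ ᵥ* B.map (algebraMap ℝ ℂ) + v₂ ᵥ* G.map (algebraMap ℝ ℂ) := by
    rw [Matrix.fromRows_map, Matrix.sumElim_vecMul_fromRows]
  have hS (v₁ : Fin n → ℂ) (v₂ : Fin k → ℂ) :
      Sum.elim (-v₁) v₂ ᵥ* systemMatrix A B C G 0 =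
        Sum.elim (v₁ ᵥ* A.map (algebraMap ℝ ℂ) + v₂ ᵥ* C.map (algebraMap ℝ ℂ))
          (v₁ ᵥ* B.map (algebraMap ℝ ℂ) + v₂ ᵥ* G.map (algebraMap ℝ ℂ)) := by
    rw [systemMatrix, Matrix.vecMul_fromBlocks]
    simp [Matrix.vecMul_neg, Matrix.neg_vecMul]
  constructor
  · intro h
    refine ⟨fun μ v hμ hvA hvB => ?_, fun v hv => ?_⟩
    · have := h μ (Sum.elim v 0) hμ
        (by rw [hA, hvA]; ext i; cases i <;> simp) (by rw [hB, hvB]; simp)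
      exact funext fun i => congrFun this (Sum.inl i)
    · have hv' : v = Sum.elim (-(-(v ∘ Sum.inl))) (v ∘ Sum.inr) := by
        rw [neg_neg, Sum.elim_comp_inl_inr]
      rw [hv', hS] at hv
      have := h 0 (Sum.elim (-(v ∘ Sum.inl)) (v ∘ Sum.inr)) le_rfl
        (by
          rw [hA, zero_smul]
          ext i
          cases i with
          | inl i => exact congrFun hv (Sum.inl i)
          | inr i => rfl)
        (by rw [hB]; exact funext fun i => congrFun hv (Sum.inr i))
      ext i
      cases i with
      | inl i => simpa using congrFun this (Sum.inl i)
      | inr i => simpa using congrFun this (Sum.inr i)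
  · rintro ⟨h1, h2⟩ μ v hμ hvA hvB
    obtain ⟨v₁, v₂, rfl⟩ : ∃ v₁ v₂, v = Sum.elim v₁ v₂ :=
      ⟨v ∘ Sum.inl, v ∘ Sum.inr, (Sum.elim_comp_inl_inr v).symm⟩
    rw [hA] at hvA
    rw [hB] at hvB
    have hv₁ : v₁ ᵥ* A.map (algebraMap ℝ ℂ) + v₂ ᵥ* C.map (algebraMap ℝ ℂ) = μ • v₁ :=
      funext fun i => congrFun hvA (Sum.inl i)
    have hv₂ : μ • v₂ = 0 := funext fun i => (congrFun hvA (Sum.inr i)).symm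
    rcases smul_eq_zero.1 hv₂ with rfl | rfl
    · have := h2 (Sum.elim (-v₁) v₂) (by rw [hS, hv₁, hvB]; ext i; cases i <;> simp)
      ext i
      cases i with
      | inl i => simpa using congrFun this (Sum.inl i)
      | inr i => simpa using congrFun this (Sum.inr i)
    · rw [h1 μ v₁ hμ (by simpa using hv₁) (by simpa using hvB)]
      ext i
      cases i <;> rfl

theorem isStabilizable_disturbanceA_transpose_iff {n p l : ℕ} (A : Matrix (Fin n) (Fin n) ℝ)
    (E : Matrix (Fin n) (Fin p) ℝ) (H : Matrix (Fin l) (Fin n) ℝ)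
    (F : Matrix (Fin l) (Fin p) ℝ) :
    IsStabilizable (disturbanceA A E)ᵀ (fromRows Hᵀ Fᵀ) ↔
      IsStabilizable Aᵀ Hᵀ ∧ p ≤ l ∧ ¬ IsSystemZero A E H F 0 := by
  have : (disturbanceA A E)ᵀ = integratorA Aᵀ Eᵀ := by
    simp [disturbanceA, integratorA, Matrix.fromBlocks_transpose]
  rw [this, isStabilizable_integratorA_iff, isSystemZero_transpose]

/-! ### The closed loop -/

section ClosedLoop

variable {n r d p l : ℕ} (A : Matrix (Fin n) (Fin n) ℝ) (B : Matrix (Fin n) (Fin r) ℝ)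
  (E : Matrix (Fin n) (Fin p) ℝ) (D : Matrix (Fin d) (Fin n) ℝ) (H : Matrix (Fin l) (Fin n) ℝ)
  (F : Matrix (Fin l) (Fin p) ℝ) (K₁ : Matrix (Fin r) (Fin n) ℝ) (K₂ : Matrix (Fin r) (Fin d) ℝ)
  (L : Matrix (Fin n ⊕ Fin p) (Fin l) ℝ)

/-- The separation principle: regulator and observer can be designed independently. -/
theorem isHurwitz_closedLoopMatrix_iff :
    IsHurwitz (closedLoopMatrix A B E D H F K₁ K₂ L) ↔
      IsHurwitz (integratorA A D + augmentedB d B * fromCols K₁ K₂) ∧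
        IsHurwitz (disturbanceA A E - L * fromCols H F) := by
  rw [closedLoopMatrix, isHurwitz_fromBlocks_zero₂₁, integratorA, augmentedB,
    Matrix.fromRows_mul_fromCols, Matrix.fromBlocks_add]
  simp

theorem exists_isHurwitz_closedLoopMatrix_iff :
    (∃ K₁ K₂ L, IsHurwitz (closedLoopMatrix A B E D H F K₁ K₂ L)) ↔
      IsStabilizable (integratorA A D) (augmentedB d B) ∧
        IsDetectable (disturbanceA A E) (fromCols H F) := by
  simp only [isHurwitz_closedLoopMatrix_iff]
  constructor
  · rintro ⟨K₁, K₂, L, h1, h2⟩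
    exact ⟨⟨_, h1⟩, ⟨_, h2⟩⟩
  · rintro ⟨⟨K, hK⟩, ⟨L, hL⟩⟩
    exact ⟨K.toCols₁, K.toCols₂, L, by rwa [Matrix.fromCols_toCols], hL⟩

theorem closedLoopMatrix_mulVec (x : Fin n → ℝ) (q : Fin d → ℝ) (e : Fin n ⊕ Fin p → ℝ) :
    closedLoopMatrix A B E D H F K₁ K₂ L *ᵥ Sum.elim (Sum.elim x q) e =
      Sum.elim (Sum.elim (A *ᵥ x + B *ᵥ (K₁ *ᵥ (x - e ∘ Sum.inl) + K₂ *ᵥ q)) (D *ᵥ x))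
        (disturbanceA A E *ᵥ e - L *ᵥ (fromCols H F *ᵥ e)) := by
  rw [closedLoopMatrix, Matrix.fromBlocks_mulVec, Sum.elim_comp_inl, Sum.elim_comp_inr,
    Matrix.fromBlocks_mulVec, Sum.elim_comp_inl, Sum.elim_comp_inr, Matrix.fromRows_mulVec,
    Matrix.neg_mulVec, ← Matrix.mulVec_mulVec e, Matrix.fromCols_mulVec (v := e)]
  ext ((i | i) | i)
  · simp only [Matrix.zero_mulVec, add_zero, Sum.elim_inl, Pi.add_apply, Pi.neg_apply,
      Matrix.add_mulVec, Matrix.mulVec_add, Matrix.mulVec_sub, ← Matrix.mulVec_mulVec,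
      Pi.sub_apply]
    ring
  · simp
  · simp [Matrix.sub_mulVec, ← Matrix.mulVec_mulVec, Matrix.mulVec_add]

variable {A B E D H F K₁ K₂ L}

theorem IsClosedLoopSolution.hasDerivWithinAt {w : Fin p → ℝ} {zr : Fin d → ℝ} {t₀ : ℝ}
    {x : ℝ → Fin n → ℝ} {q : ℝ → Fin d → ℝ} {ξ : ℝ → Fin n ⊕ Fin p → ℝ}
    {u : ℝ → Fin r → ℝ} {y : ℝ → Fin l → ℝ} {z : ℝ → Fin d → ℝ}
    (h : IsClosedLoopSolution A B E D H F K₁ K₂ L w zr t₀ x q ξ u y z) :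
    ∀ t ∈ Set.Ici t₀, HasDerivWithinAt
      (fun t => Sum.elim (Sum.elim (x t) (q t)) (Sum.elim (x t) w - ξ t))
      (closedLoopMatrix A B E D H F K₁ K₂ L *ᵥ
        Sum.elim (Sum.elim (x t) (q t)) (Sum.elim (x t) w - ξ t) +
          Sum.elim (Sum.elim (E *ᵥ w) (-zr)) 0) (Set.Ici t₀) t := by
  intro t ht
  have hx := hasDerivWithinAt_pi.1 (h.plant t ht)
  have hq := hasDerivWithinAt_pi.1 (h.integrator t ht)
  have hξ := hasDerivWithinAt_pi.1 (h.observer t ht)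
  have hu : K₁ *ᵥ (x t - (Sum.elim (x t) w - ξ t) ∘ Sum.inl) + K₂ *ᵥ q t = u t := by
    rw [h.control t ht]
    congr 2
    ext i
    simp
  -- The observer error satisfies a homogeneous equation: the input and the disturbance cancel.
  have he : disturbanceA A E *ᵥ (Sum.elim (x t) w - ξ t) -
        L *ᵥ (fromCols H F *ᵥ (Sum.elim (x t) w - ξ t)) =
      Sum.elim (A *ᵥ x t + B *ᵥ u t + E *ᵥ w) 0 -
        (disturbanceA A E *ᵥ ξ t + augmentedB p B *ᵥ u t + L *ᵥ (y t - fromCols H F *ᵥ ξ t)) := by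
    have h1 : disturbanceA A E *ᵥ Sum.elim (x t) w = Sum.elim (A *ᵥ x t + E *ᵥ w) 0 := by
      rw [disturbanceA, Matrix.fromBlocks_mulVec]
      simp
    have h2 : augmentedB p B *ᵥ u t = Sum.elim (B *ᵥ u t) 0 := by
      rw [augmentedB, Matrix.fromRows_mulVec, Matrix.zero_mulVec]
    have h3 : Sum.elim (A *ᵥ x t + B *ᵥ u t + E *ᵥ w) (0 : Fin p → ℝ) =
        Sum.elim (A *ᵥ x t + E *ᵥ w) 0 + Sum.elim (B *ᵥ u t) 0 := by
      ext (i | i)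
      · simp; ring
      · simp
    rw [Matrix.mulVec_sub, Matrix.mulVec_sub, Matrix.fromCols_mulVec_sumElim,
      ← h.measured t ht, h1, h2, h3]
    abel
  rw [closedLoopMatrix_mulVec, hu, he, hasDerivWithinAt_pi]
  rintro ((i | i) | (i | i))
  · exact (hx i).congr_deriv (by simp)
  · exact (hq i).congr_deriv (by simp [h.regulated t ht, sub_eq_add_neg])
  · exact ((hx i).sub (hξ (Sum.inl i))).congr_deriv (by simp)
  · exact ((hasDerivWithinAt_const t _ (w i)).sub (hξ (Sum.inr i))).congr_deriv (by simp)

/-- A stable closed loop converges to an equilibrium, where the integrator equation forces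
`z = zr`. -/
theorem IsTrackingPIRegulator.of_isHurwitz
    (hM : IsHurwitz (closedLoopMatrix A B E D H F K₁ K₂ L)) :
    IsTrackingPIRegulator A B E D H F K₁ K₂ L := by
  refine ⟨hM, fun w zr t₀ x q ξ u y z h => ?_⟩
  obtain ⟨e, he, hlim⟩ := hM.exists_equilibrium _ h.hasDerivWithinAt
  have he' : D *ᵥ (fun i => e (Sum.inl (Sum.inl i))) = zr := by
    have e_eq : e = Sum.elim (Sum.elim (fun i => e (Sum.inl (Sum.inl i)))
        (fun i => e (Sum.inl (Sum.inr i)))) (fun i => e (Sum.inr i)) := by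
      ext ((i | i) | i) <;> rfl
    rw [e_eq, closedLoopMatrix_mulVec] at he
    ext i
    have := congrFun he (Sum.inl (Sum.inr i))
    simp only [Pi.add_apply, Sum.elim_inl, Sum.elim_inr, Pi.neg_apply, Pi.zero_apply] at this
    linarith
  have hx : Tendsto x atTop (𝓝 fun i => e (Sum.inl (Sum.inl i))) := by
    rw [tendsto_pi_nhds] at hlim ⊢
    exact fun i => hlim (Sum.inl (Sum.inl i))
  have hz : Tendsto (fun t => D *ᵥ x t) atTop (𝓝 zr) := by
    rw [← he']
    exact ((Continuous.matrix_mulVec continuous_const continuous_id).tendsto _).comp hx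
  refine hz.congr' ?_
  filter_upwards [eventually_ge_atTop t₀] with t ht
  exact (h.regulated t ht).symm

end ClosedLoop

theorem theorem10p1 (n r d p l : ℕ)
    (A : Matrix (Fin n) (Fin n) ℝ) (B : Matrix (Fin n) (Fin r) ℝ)
    (E : Matrix (Fin n) (Fin p) ℝ) (D : Matrix (Fin d) (Fin n) ℝ)
    (H : Matrix (Fin l) (Fin n) ℝ) (F : Matrix (Fin l) (Fin p) ℝ) :
    ((∃ (K₁ : Matrix (Fin r) (Fin n) ℝ) (K₂ : Matrix (Fin r) (Fin d) ℝ)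
        (L : Matrix (Fin n ⊕ Fin p) (Fin l) ℝ),
        IsTrackingPIRegulator A B E D H F K₁ K₂ L) ↔
      IsStabilizable A B ∧ IsDetectable A H ∧ d ≤ r ∧ p ≤ l ∧
        ¬ IsSystemZero A E H F 0 ∧ ¬ IsSystemZero A B D 0 0) ∧
    (IsStabilizable (integratorA A D) (augmentedB d B) ↔
      IsStabilizable A B ∧ d ≤ r ∧ ¬ IsSystemZero A B D 0 0) ∧
    (IsStabilizable (disturbanceA A E)ᵀ (fromRows Hᵀ Fᵀ) ↔
      IsStabilizable Aᵀ Hᵀ ∧ p ≤ l ∧ ¬ IsSystemZero A E H F 0) := by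
  have hreg : IsStabilizable (integratorA A D) (augmentedB d B) ↔
      IsStabilizable A B ∧ d ≤ r ∧ ¬ IsSystemZero A B D 0 0 :=
    isStabilizable_integratorA_iff A B D 0
  have hobs := isStabilizable_disturbanceA_transpose_iff A E H F
  refine ⟨?_, hreg, hobs⟩
  have htrack : (∃ K₁ K₂ L, IsTrackingPIRegulator A B E D H F K₁ K₂ L) ↔
      ∃ K₁ K₂ L, IsHurwitz (closedLoopMatrix A B E D H F K₁ K₂ L) :=
    exists_congr fun _ => exists_congr fun _ => exists_congr fun _ =>
      ⟨fun h => h.stable, .of_isHurwitz⟩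
  rw [htrack, exists_isHurwitz_closedLoopMatrix_iff, hreg,
    isDetectable_iff_isStabilizable_transpose, Matrix.transpose_fromCols, hobs,
    isDetectable_iff_isStabilizable_transpose]
  tauto
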